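/- Let $G$ be a finite group with a Hausdorff group topology (hence discrete), and let $L$ be a locally convex linear $G$-space, i.e. a Hausdorff locally convex real topological vector space with a continuous linear action of $G$. Let $V\subset L$ be a convex $G$-subset (that is, a $G$-invariant convex subset) whose closure $\overline V$ in $L$ is metrizable. Then: (1) $V$ is $G$-homotopy dense in $\overline V$: there is a continuous map $F:\overline V\times[0,1]\to\overline V$ with $F(gx,t)=gF(x,t)$ for all $g\in G$, $x\in\overline V$, $t\in[0,1]$, such that $F(x,0)=x$ for all $x\in\overline V$ and $F(\overline V\times(0,1])\subset V$. (2) If $V\neq\emptyset$, then $(\overline V,V)$ is a $G$-AR-pair: for every metrizable space $Z$ with a continuous action of $G$, every closed $G$-invariant subset $B\subset Z$ and every continuous equivariant map $f:B\to\overline V$, there is a continuous equivariant map $F:Z\to\overline V$ with $F|_B=f$ and $F(Z\setminus B)\subset V$. -/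

import Mathlib

universe w u v

namespace GSpace

open scoped unitInterval

/-- The closure of a `G`-subset of a `G`-space, as a `G`-subset. -/
def closure {G X : Type*} [Monoid G] [MulAction G X] [TopologicalSpace X]
    [ContinuousConstSMul G X] (V : SubMulAction G X) : SubMulAction G X where
  carrier := _root_.closure (V : Set X)
  smul_mem' g _ hx :=
    map_mem_closure (continuous_const_smul g) hx fun _ hy => V.smul_mem g hy

/-- A `G`-subset `V` of a `G`-space, seen as a `G`-subset of the `G`-space `closure V`. -/
def inClosure {G X : Type*} [Monoid G] [MulAction G X] [TopologicalSpace X]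
    [ContinuousConstSMul G X] (V : SubMulAction G X) : SubMulAction G (closure V) where
  carrier := {x | (x : X) ∈ V}
  smul_mem' g _ hx := V.smul_mem g hx

/-- The `G`-subset `Z` is `G`-homotopy dense in the `G`-space `X`: there is a homotopy
`F : X × [0,1] → X`, equivariant for the diagonal action `g (x, t) = (g x, t)`, with `F₀ = id`
and `F (X × (0,1]) ⊆ Z`. -/
def IsGHomotopyDense {G X : Type*} [Group G] [TopologicalSpace G] [TopologicalSpace X]
    [MulAction G X] [ContinuousSMul G X] (Z : SubMulAction G X) : Prop :=
  ∃ F : C(X × I, X),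
    (∀ (g : G) (x : X) (t : I), F (g • x, t) = g • F (x, t)) ∧
    (∀ x : X, F (x, 0) = x) ∧
    ∀ (x : X) (t : I), 0 < t → F (x, t) ∈ Z

/-- The pair `(X, A)`, with `X` a metrizable `G`-space and `A` a `G`-subset, is a `G`-AR-pair: for
every closed `G`-subset `B` of a metrizable `G`-space `Z`, every `G`-map `f : B → X` extends to a
`G`-map `F : Z → X` with `F (Z \ B) ⊆ A`. The test spaces `Z` range over the universe `w`. -/
def IsGARPair {G : Type u} {X : Type v} [Group G] [TopologicalSpace G]
    [TopologicalSpace X] [TopologicalSpace.MetrizableSpace X] [MulAction G X] [ContinuousSMul G X]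
    (A : SubMulAction G X) : Prop :=
  ∀ (Z : Type w) [TopologicalSpace Z] [TopologicalSpace.MetrizableSpace Z] [MulAction G Z]
    [ContinuousSMul G Z] (B : SubMulAction G Z), IsClosed (B : Set Z) →
    ∀ f : B →[G] X, Continuous f →
      ∃ F : Z →[G] X, Continuous F ∧ (∀ b : B, F b = f b) ∧ ∀ z : Z, z ∉ B → F z ∈ A

end GSpace

/-! Part (2) is Dugundji's extension followed by averaging. Off `B`, a partition of unity
(`exists_continuous_forall_mem_convex_of_local_const`) blends points of `V` close to values of `f`
at nearly nearest points of `B`; the errors vanish at `B`, and local convexity gives continuity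
there. Averaging `g • E (g⁻¹ • z)` over the finite group gives equivariance; it keeps values in `V`,
which is convex and invariant, and fixes `f`, which is already equivariant. Part (1) for nonempty
`V` is (2) applied to a cylinder. -/

open Topology in
/-- Dugundji's extension theorem with control of the values off the closed set: a continuous map
from a closed subset of a metrizable space to the metrizable closure of a convex set `V` extends
to the whole space so that the points off the closed set are mapped into `V`. -/
theorem Convex.exists_continuous_extension_closure {Z E : Type*} [TopologicalSpace Z]
    [TopologicalSpace.MetrizableSpace Z] [AddCommGroup E] [Module ℝ E] [TopologicalSpace E]
    [IsTopologicalAddGroup E] [ContinuousSMul ℝ E] [LocallyConvexSpace ℝ E] {V : Set E}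
    (hV : Convex ℝ V) (hne : V.Nonempty) (hm : TopologicalSpace.MetrizableSpace (closure V))
    {B : Set Z} (hB : IsClosed B) {f : B → closure V} (hf : Continuous f) :
    ∃ F : Z → E, Continuous F ∧ (∀ b : B, F b = f b) ∧ ∀ z ∉ B, F z ∈ V := by
  classical
  let := TopologicalSpace.metrizableSpaceMetric Z
  let := TopologicalSpace.metrizableSpaceMetric (closure V)
  -- `Metric.infDist` to the empty set is 0 by default, which would make every `S z` below empty.
  obtain rfl | hBne := B.eq_empty_or_nonempty
  · obtain ⟨v, hv⟩ := hne
    exact ⟨fun _ => v, continuous_const, fun b => b.2.elim, fun _ _ => hv⟩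
  let S : Z → Set E := fun z => {v | ∃ (hv : v ∈ V) (b : B), dist z b < 2 * Metric.infDist z B ∧
    dist (⟨v, subset_closure hv⟩ : closure V) (f b) < Metric.infDist z B}
  have hSV : ∀ z, convexHull ℝ (S z) ⊆ V := fun z => convexHull_min (fun v hv => hv.1) hV
  -- Both inequalities defining `S` are strict and continuous in `z`, so one `v` serves for all
  -- nearby points.
  have hlocal : ∀ z : (Bᶜ : Set Z), ∃ c : E, ∀ᶠ y : (Bᶜ : Set Z) in 𝓝 z,
      c ∈ convexHull ℝ (S y) := by
    intro z
    have hpos : 0 < Metric.infDist (z : Z) B := (hB.notMem_iff_infDist_pos hBne).1 z.2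
    obtain ⟨b, hbB, hb⟩ := (Metric.infDist_lt_iff hBne).1
      (show Metric.infDist (z : Z) B < 2 * Metric.infDist (z : Z) B by linarith)
    have hdense : DenseRange (Set.inclusion (subset_closure : V ⊆ closure V)) :=
      denseRange_inclusion_iff _ |>.2 subset_rfl
    obtain ⟨⟨v, hv⟩, hvd⟩ := hdense.exists_dist_lt (f ⟨b, hbB⟩) hpos
    have hcont : Continuous fun y : (Bᶜ : Set Z) => Metric.infDist (y : Z) B :=
      (Metric.continuous_infDist_pt B).comp continuous_subtype_val
    have h₁ : ∀ᶠ y : (Bᶜ : Set Z) in 𝓝 z, dist (y : Z) b < 2 * Metric.infDist (y : Z) B :=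
      (continuous_subtype_val.dist continuous_const).continuousAt.eventually_lt
        (continuous_const.mul hcont).continuousAt hb
    have h₂ : ∀ᶠ y : (Bᶜ : Set Z) in 𝓝 z,
        dist (⟨v, subset_closure hv⟩ : closure V) (f ⟨b, hbB⟩) < Metric.infDist (y : Z) B :=
      continuousAt_const.eventually_lt hcont.continuousAt (by rw [dist_comm]; exact hvd)
    refine ⟨v, ?_⟩
    filter_upwards [h₁, h₂] with y hy₁ hy₂
    exact subset_convexHull ℝ _ ⟨hv, ⟨b, hbB⟩, hy₁, hy₂⟩
  obtain ⟨g, hg⟩ := exists_continuous_forall_mem_convex_of_local_const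
    (fun z : (Bᶜ : Set Z) => convex_convexHull ℝ (S z)) hlocal
  let F : Z → E := fun z => if h : z ∈ B then f ⟨z, h⟩ else g ⟨z, h⟩
  have hFB : ∀ b : B, F b = f b := fun b => dif_pos b.2
  have hFC : ∀ z (h : z ∉ B), F z = g ⟨z, h⟩ := fun z h => dif_neg h
  refine ⟨F, continuous_iff_continuousAt.2 fun z => ?_, hFB, fun z hz => ?_⟩
  · by_cases hz : z ∈ B
    · lift z to B using hz
      rw [ContinuousAt, hFB,
        -- Convex neighbourhoods are needed: balls of the metric on `closure V` need not be convex,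
        -- and `g y` is only known to lie in a convex hull.
        (LocallyConvexSpace.convex_basis (𝕜 := ℝ) (f z : E)).tendsto_right_iff]
      rintro W ⟨hW, hWc⟩
      have hW' : Subtype.val ⁻¹' W ∈ 𝓝 (f z) := continuous_subtype_val.continuousAt hW
      obtain ⟨ε, hε, hball⟩ := Metric.mem_nhds_iff.1 hW'
      obtain ⟨δ, hδ, hfδ⟩ := Metric.continuous_iff.1 hf z (ε / 2) (half_pos hε)
      -- For `b` as in `S y`, `dist b z ≤ dist y b + dist y z < 3 * dist y z`, hence `δ / 3`; the
      -- error `dist v (f b)` is below `dist y z`, hence `ε / 2`.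
      filter_upwards [Metric.ball_mem_nhds (z : Z) (show 0 < min (δ / 3) (ε / 2) by positivity)]
        with y hy
      obtain ⟨hyδ, hyε⟩ := lt_min_iff.1 (Metric.mem_ball.1 hy)
      by_cases hyB : y ∈ B
      · lift y to B using hyB
        rw [id, hFB]
        refine hball (Metric.mem_ball.2 ((hfδ y ?_).trans (half_lt_self hε)))
        rw [Subtype.dist_eq]
        linarith
      · rw [id, hFC y hyB]
        refine convexHull_min ?_ hWc (hg ⟨y, hyB⟩)
        rintro v ⟨hv, b, hb, hvb⟩
        have hle : Metric.infDist y B ≤ dist y z := Metric.infDist_le_dist_of_mem z.2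
        have hbz : dist b z < δ := by
          rw [Subtype.dist_eq]
          linarith [dist_triangle_left (b : Z) z y]
        refine hball (a := ⟨v, subset_closure hv⟩) (Metric.mem_ball.2 ?_)
        linarith [hfδ b hbz, dist_triangle (⟨v, subset_closure hv⟩ : closure V) (f b) (f z)]
    · have hres : ContinuousOn F Bᶜ := by
        rw [continuousOn_iff_continuous_domRestrict]
        exact g.continuous.congr fun y => (hFC y y.2).symm
      exact hres.continuousAt (hB.isOpen_compl.mem_nhds hz)
  · rw [hFC z hz]
    exact hSV z (hg ⟨z, hz⟩)

namespace GSpace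

open scoped unitInterval in
/-- A `G`-AR-pair is `G`-homotopy dense: extend the identity from the base of the cylinder. -/
theorem IsGARPair.isGHomotopyDense {G : Type u} [Group G] [TopologicalSpace G]
    {X : Type v} [TopologicalSpace X]
    [TopologicalSpace.MetrizableSpace X] [MulAction G X] [ContinuousSMul G X]
    {A : SubMulAction G X} (h : IsGARPair.{v} A) : IsGHomotopyDense A := by
  -- With the trivial action on `I`, the product action on `X × I` is the diagonal one of the
  -- homotopy.
  let : MulAction G I :=
    { smul := fun _ t => t, one_smul := fun _ => rfl, mul_smul := fun _ _ _ => rfl }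
  have : ContinuousSMul G I := ⟨continuous_snd⟩
  let B : SubMulAction G (X × I) :=
    { carrier := {p | p.2 = 0}, smul_mem' := fun _ _ hp => hp }
  obtain ⟨F, hF, hFB, hFA⟩ := h (X × I) B (isClosed_eq continuous_snd continuous_const)
    ⟨fun p => p.1.1, fun _ _ => rfl⟩ (continuous_fst.comp continuous_subtype_val)
  exact ⟨⟨F, hF⟩, fun g x t => map_smul F g (x, t), fun x => hFB ⟨(x, 0), rfl⟩,
    fun x t ht => hFA (x, t) ht.ne'⟩

variable {G : Type u} [Group G] [Finite G] [TopologicalSpace G]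
  {L : Type v} [AddCommGroup L] [Module ℝ L] [TopologicalSpace L] [IsTopologicalAddGroup L]
  [ContinuousSMul ℝ L] [LocallyConvexSpace ℝ L]
  [DistribMulAction G L] [SMulCommClass G ℝ L] [ContinuousSMul G L]

/-- For a finite group `G`, averaging an extension over `G` makes it equivariant. -/
theorem isGARPair_inClosure {V : SubMulAction G L} (hV : Convex ℝ (V : Set L))
    [TopologicalSpace.MetrizableSpace (closure V)] (hne : (V : Set L).Nonempty) :
    IsGARPair.{w} (inClosure V) := by
  intro Z _ _ _ _ B hB f hf
  cases nonempty_fintype G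
  obtain ⟨E, hE, hEB, hEV⟩ := hV.exists_continuous_extension_closure hne
    (inferInstanceAs (TopologicalSpace.MetrizableSpace (closure V))) hB hf
  let A : Z → L := fun z => ∑ g : G, (Fintype.card G : ℝ)⁻¹ • g • E (g⁻¹ • z)
  have hcard : (Fintype.card G : ℝ) ≠ 0 := Nat.cast_ne_zero.2 Fintype.card_ne_zero
  have hA : Continuous A := continuous_finsetSum _ fun g _ =>
    ((hE.comp (continuous_const_smul g⁻¹)).const_smul g).const_smul _
  have hAsmul : ∀ (h : G) (z : Z), A (h • z) = h • A z := by
    intro h z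
    simp only [A, Finset.smul_sum]
    refine (Fintype.sum_equiv (Equiv.mulLeft h) _ _ fun g => ?_).symm
    simp [smul_smul, mul_assoc, smul_comm h]
  have hAB : ∀ b : B, A b = f b := by
    intro b
    have : ∀ g : G, g • E (g⁻¹ • (b : Z)) = f b := by
      intro g
      have h := hEB (g⁻¹ • b)
      rw [SubMulAction.val_smul] at h
      rw [h]
      change g • ((f (g⁻¹ • b) : closure V) : L) = f b
      rw [map_smul, SubMulAction.val_smul, smul_inv_smul]
    simp only [A, this]
    rw [Finset.sum_const, Finset.card_univ, ← Nat.cast_smul_eq_nsmul ℝ, smul_inv_smul₀ hcard]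
  have hAV : ∀ z, z ∉ B → A z ∈ V := by
    intro z hz
    refine hV.sum_mem (fun _ _ => by positivity) (by simp [hcard]) fun g _ => ?_
    refine V.smul_mem g (hEV _ fun h => hz ?_)
    simpa using B.smul_mem g h
  have hAcl : ∀ z, A z ∈ closure V := by
    intro z
    by_cases hz : z ∈ B
    · exact hAB ⟨z, hz⟩ ▸ (f ⟨z, hz⟩).2
    · exact subset_closure (hAV z hz)
  exact ⟨⟨fun z => ⟨A z, hAcl z⟩, fun h z => Subtype.ext (hAsmul h z)⟩, hA.subtype_mk _,
    fun b => Subtype.ext (hAB b), hAV⟩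

end GSpace

theorem proposition3p5 {G : Type u} [Group G] [Finite G] [TopologicalSpace G]
    [IsTopologicalGroup G] [T2Space G]
    {L : Type v} [AddCommGroup L] [Module ℝ L] [TopologicalSpace L] [IsTopologicalAddGroup L]
    [ContinuousSMul ℝ L] [T2Space L] [LocallyConvexSpace ℝ L]
    [DistribMulAction G L] [SMulCommClass G ℝ L] [ContinuousSMul G L]
    (V : SubMulAction G L) (hV : Convex ℝ (V : Set L))
    [TopologicalSpace.MetrizableSpace (GSpace.closure V)] :
    GSpace.IsGHomotopyDense (GSpace.inClosure V) ∧
      ((V : Set L).Nonempty → GSpace.IsGARPair.{w} (GSpace.inClosure V)) := by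
  refine ⟨?_, GSpace.isGARPair_inClosure hV⟩
  obtain hne | hne := (V : Set L).eq_empty_or_nonempty
  · have hcl : IsEmpty (GSpace.closure V) :=
      ⟨fun x => by simpa [hne] using (show (x : L) ∈ closure (V : Set L) from x.2)⟩
    exact ⟨⟨Prod.fst, continuous_fst⟩, fun _ x => isEmptyElim x, fun x => isEmptyElim x,
      fun x => isEmptyElim x⟩
  · exact (GSpace.isGARPair_inClosure hV hne).isGHomotopyDense
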